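/- Let $(B_t)_{t\ge 0}$ be a complex-valued Brownian motion starting at $i$, that is, $\operatorname{Re}(B_t)$ and $\operatorname{Im}(B_t)-1$ are independent standard real Brownian motions with almost surely continuous paths. Let $$T=\inf\{t\ge 0 : \operatorname{Im}(B_t)\le 0\}$$ be the exit time of $B$ from the upper half-plane $\{z\in\mathbb{C} : \operatorname{Im} z>0\}$. Then $T<\infty$ almost surely, and $B_T$ has the standard Cauchy distribution: $B_T$ is almost surely real, and its law on $\mathbb{R}$ has density $\dfrac{1}{\pi(1+x^2)}$ with respect to Lebesgue measure. -/

import Mathlib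

open MeasureTheory ProbabilityTheory
open scoped NNReal

/-- A complex-valued (planar) Brownian motion `B` started at `z`, under the measure `P`: the
processes `Re (B t - z)` and `Im (B t - z)` are independent standard real Brownian motions
(with almost surely continuous paths). -/
structure IsComplexBrownian {Ω : Type*} [MeasurableSpace Ω] (B : ℝ≥0 → Ω → ℂ) (z : ℂ)
    (P : Measure Ω) : Prop where
  isBrownianReal_re : IsBrownianReal (fun t ω ↦ (B t ω - z).re) P
  isBrownianReal_im : IsBrownianReal (fun t ω ↦ (B t ω - z).im) P
  indepFun_re_im :
    IndepFun (fun ω (t : ℝ≥0) ↦ (B t ω - z).re) (fun ω (t : ℝ≥0) ↦ (B t ω - z).im) P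

/-- The exit time of the process `B` from the set `U`: `inf {t ≥ 0 | B t ∉ U}`, with value `⊤` if
the path never leaves `U`. -/
noncomputable def exitTime {Ω : Type*} (B : ℝ≥0 → Ω → ℂ) (U : Set ℂ) : Ω → WithTop ℝ≥0 :=
  hittingAfter B Uᶜ 0

/-!
Write `X = Re B` and `W = Im B - 1`, two independent standard real Brownian motions. The exit time
`T` is the time when `W` first reaches `-1`, and `B_T = X_T` because `W_T = -1`. As `T` depends on
`W` only, `X_T` is, conditionally on `T`, a centred Gaussian variable of variance `T`, so that
`E[exp (iξ X_T)] = E[exp (-ξ² T / 2)]`. The Laplace transform of `T` comes from optional stopping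
for the exponential martingale `exp (-l W_t - l² t / 2)`, which gives `E[exp (-l² T / 2)] = exp (-l)`
for `l > 0`; letting `l` tend to `0` shows that `T` is almost surely finite. Hence `X_T` has
characteristic function `exp (-|ξ|)`, which is that of the Cauchy distribution
(`charFun_cauchyMeasure_zero_one`).

Both expectations are instances of `integral_mul_stopped_eq`, a form of optional stopping for a
bounded stopping time `τ`: a factor `V s` which is independent of the past up to time `s` may be
replaced at `τ` by its mean. For the Laplace transform the past is that of `W` up to time `s`, for
`X_T` it is the whole path of `W`. To have bounded times, `T` is capped at an integer `m`
(`cappedHit`); this changes `E[exp (-l² T / 2)]` by at most `exp (-l² m / 2)`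
(`abs_integral_exp_cappedHit_sub_le`). The processes are first replaced by indistinguishable ones
with measurable marginals and everywhere continuous paths
(`exists_measurable_continuous_modification`), so that the capped hitting times are stopping times.
-/

open Filter Topology

/-! ### The characteristic function of the Cauchy distribution -/

section Cauchy

open scoped FourierTransform
open Real

lemma integrable_cexp_neg_two_pi_abs : Integrable (fun x : ℝ ↦ (Real.exp (-2 * π * |x|) : ℂ)) := by
  suffices h : Integrable fun x : ℝ ↦ Real.exp (-2 * π * |x|) from h.ofReal
  rw [← integrableOn_univ, ← Set.Iic_union_Ioi (a := (0 : ℝ)), integrableOn_union]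
  constructor
  · refine (integrableOn_exp_mul_Iic (a := 2 * π) (by positivity) 0).congr_fun ?_ measurableSet_Iic
    intro x hx
    simp only
    rw [abs_of_nonpos hx]; ring_nf
  · refine (integrableOn_exp_mul_Ioi (a := -2 * π) (by nlinarith [pi_pos]) 0).congr_fun ?_
      measurableSet_Ioi
    intro x hx
    simp only
    rw [abs_of_pos hx]

lemma fourier_cexp_neg_two_pi_abs (w : ℝ) :
    𝓕 (fun x : ℝ ↦ (Real.exp (-2 * π * |x|) : ℂ)) w = (cauchyPDFReal 0 1 w : ℂ) := by
  rw [Real.fourier_real_eq_integral_exp_smul]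
  have hint : Integrable (fun v : ℝ ↦ Complex.exp (↑(-2 * π * v * w) * Complex.I) •
      (Real.exp (-2 * π * |v|) : ℂ)) := by
    refine integrable_cexp_neg_two_pi_abs.bdd_mul (c := 1) (by fun_prop) ?_
    exact ae_of_all _ fun v ↦ by rw [Complex.norm_exp_ofReal_mul_I]
  rw [← intervalIntegral.integral_Iic_add_Ioi (b := 0) hint.integrableOn hint.integrableOn]
  have h1 : ∫ v in Set.Iic (0 : ℝ), Complex.exp (↑(-2 * π * v * w) * Complex.I) •
      (Real.exp (-2 * π * |v|) : ℂ) =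
      ∫ v in Set.Iic (0 : ℝ), Complex.exp ((2 * π * (1 - w * Complex.I)) * v) := by
    refine setIntegral_congr_fun measurableSet_Iic fun x hx ↦ ?_
    rw [abs_of_nonpos hx, smul_eq_mul, Complex.ofReal_exp, ← Complex.exp_add]
    push_cast; ring_nf
  have h2 : ∫ v in Set.Ioi (0 : ℝ), Complex.exp (↑(-2 * π * v * w) * Complex.I) •
      (Real.exp (-2 * π * |v|) : ℂ) =
      ∫ v in Set.Ioi (0 : ℝ), Complex.exp ((-2 * π * (1 + w * Complex.I)) * v) := by
    refine setIntegral_congr_fun measurableSet_Ioi fun x hx ↦ ?_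
    rw [abs_of_pos hx, smul_eq_mul, Complex.ofReal_exp, ← Complex.exp_add]
    push_cast; ring_nf
  rw [h1, h2, integral_exp_mul_complex_Iic (by simp [pi_pos]),
    integral_exp_mul_complex_Ioi (by simp [pi_pos])]
  have e1 : (1 - w * Complex.I) ≠ 0 := fun h ↦ by simpa using congrArg Complex.re h
  have e2 : (1 + w * Complex.I) ≠ 0 := fun h ↦ by simpa using congrArg Complex.re h
  have e3 : ((w : ℂ) ^ 2 + 1) ≠ 0 := by
    have : (w ^ 2 + 1 : ℝ) ≠ 0 := by positivity
    exact_mod_cast this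
  have e4 : (π : ℂ) ≠ 0 := by exact_mod_cast pi_ne_zero
  rw [cauchyPDFReal_def]
  push_cast
  simp only [mul_zero, Complex.exp_zero, sub_zero, mul_one, one_pow]
  have key : ((w : ℂ) ^ 2 + 1) = (1 - w * Complex.I) * (1 + w * Complex.I) := by
    ring_nf; rw [Complex.I_sq]; ring
  rw [key]
  field_simp
  ring

/-- By Fourier inversion, as the Cauchy density is the Fourier transform of `exp (-2π|x|)`. -/
lemma charFun_cauchyMeasure_zero_one (ξ : ℝ) :
    charFun (cauchyMeasure 0 1) ξ = (Real.exp (-|ξ|) : ℂ) := by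
  have hF : 𝓕 (fun x : ℝ ↦ (Real.exp (-2 * π * |x|) : ℂ)) =
      fun w ↦ (cauchyPDFReal 0 1 w : ℂ) := funext fourier_cexp_neg_two_pi_abs
  have hinv := Continuous.fourierInv_fourier_eq
    (f := fun x : ℝ ↦ (Real.exp (-2 * π * |x|) : ℂ)) (by fun_prop)
    integrable_cexp_neg_two_pi_abs (by rw [hF]; exact (integrable_cauchyPDFReal 0).ofReal)
  have h := congrFun hinv (ξ / (2 * π))
  rw [hF, Real.fourierInv_eq'] at h
  rw [charFun_apply_real, cauchyMeasure_of_scale_ne_zero _ one_ne_zero,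
    integral_withDensity_eq_integral_toReal_smul (measurable_cauchyPDF 0 1)
      (ae_of_all _ fun _ ↦ ENNReal.ofReal_lt_top)]
  have hs : -2 * π * |ξ / (2 * π)| = -|ξ| := by
    rw [abs_div, abs_of_pos (by positivity : 0 < 2 * π)]
    field_simp
  rw [hs] at h
  rw [← h]
  refine integral_congr_ae (ae_of_all _ fun x ↦ ?_)
  simp only [cauchyPDF]
  rw [ENNReal.toReal_ofReal (cauchyPDF_pos 0 one_ne_zero x).le, Complex.real_smul, smul_eq_mul,
    mul_comm]
  congr 2
  have : (π : ℂ) ≠ 0 := by exact_mod_cast pi_ne_zero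
  simp
  field_simp

end Cauchy

/-! ### Paths and modifications -/

/-- The first time at which the path `f` is at most `a`, capped at `m`. -/
noncomputable def cappedHit (f : ℝ≥0 → ℝ) (a : ℝ) (m : ℝ≥0) : ℝ≥0 :=
  sInf ({s | f s ≤ a} ∪ {m})

lemma cappedHit_le (f : ℝ≥0 → ℝ) (a : ℝ) (m : ℝ≥0) : cappedHit f a m ≤ m :=
  csInf_le (OrderBot.bddBelow _) (by simp)

lemma cappedHit_mem {f : ℝ≥0 → ℝ} (hf : Continuous f) (a : ℝ) (m : ℝ≥0) :
    f (cappedHit f a m) ≤ a ∨ cappedHit f a m = m := by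
  have hcl : IsClosed ({s | f s ≤ a} ∪ {m}) :=
    (isClosed_le hf continuous_const).union isClosed_singleton
  have h : cappedHit f a m ∈ {s | f s ≤ a} ∪ {m} :=
    hcl.csInf_mem ⟨m, by simp⟩ (OrderBot.bddBelow _)
  simpa [or_comm] using h

lemma cappedHit_le_of_apply_le {f : ℝ≥0 → ℝ} {a : ℝ} {m s : ℝ≥0} (h : f s ≤ a) :
    cappedHit f a m ≤ s :=
  csInf_le (OrderBot.bddBelow _) (by simp [h])

lemma lt_of_lt_cappedHit {f : ℝ≥0 → ℝ} {a : ℝ} {m s : ℝ≥0} (hs : s < cappedHit f a m) :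
    a < f s := by
  by_contra! h
  exact (cappedHit_le_of_apply_le h).not_gt hs

lemma le_apply_cappedHit {f : ℝ≥0 → ℝ} (hf : Continuous f) {a : ℝ} (h0 : a ≤ f 0) (m : ℝ≥0) :
    a ≤ f (cappedHit f a m) := by
  rcases eq_or_ne (cappedHit f a m) 0 with h | h
  · rwa [h]
  · have hne : (𝓝[Set.Iio (cappedHit f a m)] (cappedHit f a m)).NeBot :=
      nhdsLT_neBot_of_exists_lt ⟨0, pos_of_ne_zero h⟩
    refine ge_of_tendsto ((hf.tendsto (cappedHit f a m)).mono_left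
      (nhdsWithin_le_nhds (s := Set.Iio (cappedHit f a m)))) ?_
    filter_upwards [self_mem_nhdsWithin] with s hs using (lt_of_lt_cappedHit hs).le

lemma cappedHit_le_iff {f : ℝ≥0 → ℝ} (hf : Continuous f) {a : ℝ} {m s : ℝ≥0} :
    cappedHit f a m ≤ s ↔ m ≤ s ∨ ∃ u ≤ s, f u ≤ a := by
  constructor
  · intro h
    rcases cappedHit_mem hf a m with h' | h'
    · exact Or.inr ⟨_, h, h'⟩
    · exact Or.inl (h' ▸ h)
  · rintro (h | ⟨u, hu, h⟩)
    · exact (cappedHit_le f a m).trans h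
    · exact (cappedHit_le_of_apply_le h).trans hu

lemma cappedHit_eq_sInf {f : ℝ≥0 → ℝ} {a : ℝ} {m : ℝ≥0} (h : ∃ u, f u ≤ a)
    (hm : sInf {s | f s ≤ a} ≤ m) : cappedHit f a m = sInf {s | f s ≤ a} := by
  refine le_antisymm (le_csInf h fun s hs ↦ cappedHit_le_of_apply_le hs)
    (le_csInf ⟨m, by simp⟩ fun s hs ↦ ?_)
  rcases hs with hs | hs
  · exact csInf_le (OrderBot.bddBelow _) hs
  · rwa [Set.mem_singleton_iff.1 hs]

lemma apply_sInf_eq {f : ℝ≥0 → ℝ} (hf : Continuous f) {a : ℝ} (h0 : a ≤ f 0)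
    (h : ∃ u, f u ≤ a) : f (sInf {s | f s ≤ a}) = a := by
  refine le_antisymm ?_ ?_
  · exact (isClosed_le hf continuous_const).csInf_mem h (OrderBot.bddBelow _)
  · rw [← cappedHit_eq_sInf h le_rfl]
    exact le_apply_cappedHit hf h0 _

/-- On a compact interval, a continuous path reaches `(-∞, a]` if and only if its values at
countably many times come arbitrarily close to it. -/
lemma exists_le_and_apply_le_iff {f : ℝ≥0 → ℝ} (hf : Continuous f) {a : ℝ} {s : ℝ≥0} :
    (∃ u ≤ s, f u ≤ a) ↔
      ∀ n : ℕ, ∃ k : ℕ, f (min s (TopologicalSpace.denseSeq ℝ≥0 k)) < a + 1 / ((n : ℝ) + 1) := by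
  constructor
  · rintro ⟨u, hu, h⟩ n
    have hpos : (0 : ℝ) < 1 / ((n : ℝ) + 1) := by positivity
    have hopen : IsOpen {r : ℝ≥0 | f (min s r) < a + 1 / ((n : ℝ) + 1)} :=
      isOpen_lt (by fun_prop) continuous_const
    have hne : {r : ℝ≥0 | f (min s r) < a + 1 / ((n : ℝ) + 1)}.Nonempty :=
      ⟨u, by simp only [Set.mem_ofPred_eq, min_eq_right hu]; linarith⟩
    obtain ⟨k, hk⟩ := (TopologicalSpace.denseRange_denseSeq ℝ≥0).exists_mem_open hopen hne
    exact ⟨k, hk⟩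
  · intro h
    obtain ⟨u, hu, hmin⟩ := (isCompact_Icc (a := (0 : ℝ≥0)) (b := s)).exists_isMinOn
      ⟨0, by simp⟩ hf.continuousOn
    refine ⟨u, hu.2, le_of_forall_pos_lt_add fun ε hε ↦ ?_⟩
    obtain ⟨n, hn⟩ := exists_nat_one_div_lt hε
    obtain ⟨k, hk⟩ := h n
    have : f u ≤ f (min s (TopologicalSpace.denseSeq ℝ≥0 k)) := hmin (by simp)
    linarith

/-- A process with almost surely continuous paths is indistinguishable from one all of whose paths
are continuous and all of whose marginals are measurable. -/
lemma exists_measurable_continuous_modification {Ω : Type*} [MeasurableSpace Ω] {P : Measure Ω}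
    {W : ℝ≥0 → Ω → ℝ} (hm : ∀ t, AEMeasurable (W t) P) (hc : ∀ᵐ ω ∂P, Continuous (W · ω)) :
    ∃ W' : ℝ≥0 → Ω → ℝ, (∀ t, Measurable (W' t)) ∧ (∀ ω, Continuous (W' · ω)) ∧
      ∀ᵐ ω ∂P, ∀ t, W t ω = W' t ω := by
  classical
  let q := TopologicalSpace.denseSeq ℝ≥0
  have hae : ∀ᵐ ω ∂P, Continuous (W · ω) ∧ ∀ k, W (q k) ω = (hm (q k)).mk _ ω :=
    hc.and (ae_all_iff.2 fun k ↦ (hm (q k)).ae_eq_mk)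
  obtain ⟨N, hN, hNm, hN0⟩ := exists_measurable_superset_of_null (ae_iff.1 hae)
  have hgood : ∀ ω ∉ N, Continuous (W · ω) ∧ ∀ k, W (q k) ω = (hm (q k)).mk _ ω := fun ω hω ↦ by
    by_contra h
    exact hω (hN h)
  let W' : ℝ≥0 → Ω → ℝ := fun t ω ↦ if ω ∈ N then 0 else W t ω
  have hcont : ∀ ω, Continuous (W' · ω) := fun ω ↦ by
    by_cases h : ω ∈ N
    · simpa [W', h] using continuous_const
    · simpa [W', h] using (hgood ω h).1
  have hq : ∀ k, Measurable (W' (q k)) := fun k ↦ by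
    have : W' (q k) = fun ω ↦ if ω ∈ N then 0 else (hm (q k)).mk _ ω := by
      ext ω
      by_cases h : ω ∈ N
      · simp [W', h]
      · simp [W', h, (hgood ω h).2 k]
    rw [this]
    exact Measurable.ite hNm measurable_const (hm (q k)).measurable_mk
  refine ⟨W', fun t ↦ ?_, hcont, ?_⟩
  · obtain ⟨u, hu, hut⟩ := mem_closure_iff_seq_limit.1
      (TopologicalSpace.denseRange_denseSeq ℝ≥0 t)
    choose k hk using hu
    refine measurable_of_tendsto_metrizable (f := fun n ↦ W' (u n)) (fun n ↦ ?_)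
      (tendsto_pi_nhds.2 fun ω ↦ ((hcont ω).tendsto t).comp hut)
    rw [← hk n]
    exact hq _
  · filter_upwards [measure_eq_zero_iff_ae_notMem.1 hN0] with ω hω t
    simp [W', hω]

/-! ### Stopping at a bounded stopping time -/

/-- If for every `s ≤ t` the variable `V s` is independent of the past `F s` and has mean `v s`,
and `Z` is adapted, then at a stopping time `τ ≤ t` one may replace `V` by its mean: this is a form
of optional stopping, proved by approximating `τ` from above by `⌈τ N⌉ / N`. -/
theorem integral_mul_stopped_eq {Ω 𝕜 : Type*} [mΩ : MeasurableSpace Ω] [RCLike 𝕜] {P : Measure Ω}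
    [IsProbabilityMeasure P] (F : Filtration ℝ≥0 mΩ) {t : ℕ} {τ : Ω → ℝ≥0}
    (hτ : ∀ s, MeasurableSet[F s] {ω | τ ω ≤ s}) (hτt : ∀ ω, τ ω ≤ t)
    {Z V : ℝ≥0 → Ω → 𝕜} {v : ℝ≥0 → 𝕜} (hZ : ∀ s, Measurable[F s] (Z s))
    (hV : ∀ s, Measurable (V s))
    (hind : ∀ s ≤ (t : ℝ≥0), Indep (F s) (MeasurableSpace.comap (V s) inferInstance) P)
    (hv : ∀ s ≤ (t : ℝ≥0), ∫ ω, V s ω ∂P = v s)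
    (hZc : ∀ ω, Continuous (Z · ω)) (hVc : ∀ ω, Continuous (V · ω)) (hvc : Continuous v)
    {D : Ω → ℝ} (hD : Integrable D P) (hZV : ∀ s ≤ (t : ℝ≥0), ∀ ω, ‖Z s ω * V s ω‖ ≤ D ω)
    {C : ℝ} (hZv : ∀ s ≤ (t : ℝ≥0), ∀ ω, ‖Z s ω * v s‖ ≤ C) :
    ∫ ω, Z (τ ω) ω * V (τ ω) ω ∂P = ∫ ω, Z (τ ω) ω * v (τ ω) ∂P := by
  have hτm : Measurable τ := measurable_of_Iic fun s ↦ F.le s _ (hτ s)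
  -- As `t` is an integer, the approximations of `τ` from above remain at most `t`.
  let d : ℕ → Ω → ℝ≥0 := fun n ω ↦ (⌈τ ω * (n + 1)⌉₊ : ℝ≥0) / (n + 1)
  have hdm : ∀ n, Measurable (d n) := fun n ↦ by fun_prop
  have hdt : ∀ n ω, d n ω ≤ t := fun n ω ↦ by
    rw [div_le_iff₀ (by positivity)]
    have : ⌈τ ω * (n + 1)⌉₊ ≤ t * (n + 1) := by
      rw [Nat.ceil_le]
      push_cast
      gcongr
      exact hτt ω
    exact_mod_cast this
  have hdlim : ∀ ω, Tendsto (fun n ↦ d n ω) atTop (𝓝 (τ ω)) := fun ω ↦ by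
    have h1 : Tendsto (fun n : ℕ ↦ τ ω + 1 / ((n : ℝ≥0) + 1)) atTop (𝓝 (τ ω + 0)) :=
      tendsto_const_nhds.add tendsto_one_div_add_atTop_nhds_zero_nat
    rw [add_zero] at h1
    refine tendsto_of_tendsto_of_tendsto_of_le_of_le tendsto_const_nhds h1 (fun n ↦ ?_)
      fun n ↦ ?_
    · simp only [d]
      rw [le_div_iff₀ (by positivity)]
      exact Nat.le_ceil _
    · simp only [d]
      rw [div_le_iff₀ (by positivity), add_mul, one_div, inv_mul_cancel₀ (by positivity)]
      exact (Nat.ceil_lt_add_one (by positivity)).le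
  -- The event that `d n` takes the value `k / (n + 1)` is known at that time.
  have hcell : ∀ n k : ℕ, MeasurableSet[F ((k : ℝ≥0) / (n + 1))] {ω | ⌈τ ω * (n + 1)⌉₊ = k} := by
    intro n k
    have hle : ∀ j : ℕ, {ω | ⌈τ ω * (n + 1)⌉₊ ≤ j} = {ω | τ ω ≤ (j : ℝ≥0) / (n + 1)} := fun j ↦ by
      ext ω
      simp only [Set.mem_ofPred_eq]
      rw [Nat.ceil_le, le_div_iff₀ (by positivity)]
    have hk : MeasurableSet[F ((k : ℝ≥0) / (n + 1))] {ω | ⌈τ ω * (n + 1)⌉₊ ≤ k} := by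
      rw [hle]; exact hτ _
    cases k with
    | zero => simpa using hk
    | succ j =>
      have : {ω | ⌈τ ω * (n + 1)⌉₊ = j + 1} =
          {ω | ⌈τ ω * (n + 1)⌉₊ ≤ j + 1} \ {ω | ⌈τ ω * (n + 1)⌉₊ ≤ j} := by
        ext ω; simp only [Set.mem_ofPred_eq, Set.mem_sdiff]; omega
      rw [this]
      refine hk.diff (F.mono (i := (j : ℝ≥0) / (n + 1)) ?_ _ ?_)
      · gcongr; simp
      · rw [hle]; exact hτ _
  have hsum : ∀ (U : ℝ≥0 → Ω → 𝕜) n ω, U (d n ω) ω = ∑ k ∈ Finset.range (t * (n + 1) + 1),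
      {ω | ⌈τ ω * (n + 1)⌉₊ = k}.indicator (U ((k : ℝ≥0) / (n + 1))) ω := by
    intro U n ω
    rw [Finset.sum_eq_single ⌈τ ω * (n + 1)⌉₊]
    · simp [d]
    · intro k _ hk
      simp [Ne.symm hk]
    · intro h
      refine absurd (Finset.mem_range.2 (Nat.lt_succ_of_le ?_)) h
      rw [Nat.ceil_le]
      push_cast
      gcongr
      exact hτt ω
  have hZm : ∀ s, Measurable (Z s) := fun s ↦ (hZ s).mono (F.le s) le_rfl
  have hgrid : ∀ (n k : ℕ), k ∈ Finset.range (t * (n + 1) + 1) →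
      (k : ℝ≥0) / (n + 1) ≤ t := fun n k hk ↦ by
    rw [div_le_iff₀ (by positivity)]
    exact_mod_cast Nat.lt_succ_iff.1 (Finset.mem_range.1 hk)
  have hdisc : ∀ n, ∫ ω, Z (d n ω) ω * V (d n ω) ω ∂P = ∫ ω, Z (d n ω) ω * v (d n ω) ∂P := by
    intro n
    have e1 := hsum (fun s ω ↦ Z s ω * V s ω) n
    have e2 := hsum (fun s ω ↦ Z s ω * v s) n
    simp_rw [e1, e2]
    rw [integral_finsetSum, integral_finsetSum]
    · refine Finset.sum_congr rfl fun k hk ↦ ?_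
      have hst := hgrid n k hk
      set s : ℝ≥0 := (k : ℝ≥0) / (n + 1)
      set A : Set Ω := {ω | ⌈τ ω * (n + 1)⌉₊ = k}
      have hA : MeasurableSet[F s] A := hcell n k
      have hAZ : Measurable[F s] (A.indicator (Z s)) := (hZ s).indicator hA
      have hindep : IndepFun (A.indicator (Z s)) (V s) P :=
        indep_of_indep_of_le_left (hind s hst) hAZ.comap_le
      have l1 : A.indicator (fun ω ↦ Z s ω * V s ω) = fun ω ↦ A.indicator (Z s) ω * V s ω := by
        ext ω; by_cases h : ω ∈ A <;> simp [h]
      have l2 : A.indicator (fun ω ↦ Z s ω * v s) = fun ω ↦ A.indicator (Z s) ω * v s := by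
        ext ω; by_cases h : ω ∈ A <;> simp [h]
      rw [l1, l2, integral_mul_const, hindep.integral_fun_mul_eq_mul_integral
        (hAZ.mono (F.le s) le_rfl).aestronglyMeasurable (hV s).aestronglyMeasurable, hv s hst]
    · intro k hk
      refine Integrable.indicator ?_ (F.le _ _ (hcell n k))
      exact Integrable.of_bound ((hZm _).mul_const _).aestronglyMeasurable C
        (ae_of_all _ fun ω ↦ hZv _ (hgrid n k hk) ω)
    · intro k hk
      refine Integrable.indicator ?_ (F.le _ _ (hcell n k))
      exact hD.mono' ((hZm _).mul (hV _)).aestronglyMeasurable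
        (ae_of_all _ fun ω ↦ hZV _ (hgrid n k hk) ω)
  have hcomp : ∀ {U : ℝ≥0 → Ω → 𝕜}, (∀ s, Measurable (U s)) → (∀ ω, Continuous (U · ω)) →
      ∀ n, Measurable fun ω ↦ U (d n ω) ω := fun {U} hU hUc n ↦
    (measurable_uncurry_of_continuous_of_measurable hUc hU).comp
      ((hdm n).prodMk measurable_id)
  have lim1 : Tendsto (fun n ↦ ∫ ω, Z (d n ω) ω * V (d n ω) ω ∂P) atTop
      (𝓝 (∫ ω, Z (τ ω) ω * V (τ ω) ω ∂P)) := by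
    refine tendsto_integral_of_dominated_convergence D (fun n ↦ ?_) hD
      (fun n ↦ ae_of_all _ fun ω ↦ hZV _ (hdt n ω) ω) (ae_of_all _ fun ω ↦ ?_)
    · exact ((hcomp hZm hZc n).mul (hcomp hV hVc n)).aestronglyMeasurable
    · exact (((hZc ω).mul (hVc ω)).tendsto (τ ω)).comp (hdlim ω)
  have lim2 : Tendsto (fun n ↦ ∫ ω, Z (d n ω) ω * v (d n ω) ∂P) atTop
      (𝓝 (∫ ω, Z (τ ω) ω * v (τ ω) ∂P)) := by
    refine tendsto_integral_of_dominated_convergence (fun _ ↦ C) (fun n ↦ ?_)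
      (integrable_const C)
      (fun n ↦ ae_of_all _ fun ω ↦ hZv _ (hdt n ω) ω) (ae_of_all _ fun ω ↦ ?_)
    · exact ((hcomp hZm hZc n).mul (hvc.measurable.comp (hdm n))).aestronglyMeasurable
    · exact (((hZc ω).mul hvc).tendsto (τ ω)).comp (hdlim ω)
  exact tendsto_nhds_unique lim1 (by simpa only [hdisc] using lim2)

/-! ### Hitting times of Brownian motion -/

section Hitting

variable {Ω : Type*} {W X : ℝ≥0 → Ω → ℝ}

lemma measurableSet_exists_le_apply_le (m : MeasurableSpace Ω) (hc : ∀ ω, Continuous (W · ω))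
    {s : ℝ≥0} (hW : ∀ u ≤ s, Measurable[m] (W u)) (a : ℝ) :
    MeasurableSet[m] {ω | ∃ u ≤ s, W u ω ≤ a} := by
  have : {ω | ∃ u ≤ s, W u ω ≤ a} = ⋂ n : ℕ, ⋃ k : ℕ,
      {ω | W (min s (TopologicalSpace.denseSeq ℝ≥0 k)) ω < a + 1 / ((n : ℝ) + 1)} := by
    ext ω
    simp only [Set.mem_ofPred_eq, Set.mem_iInter, Set.mem_iUnion]
    exact exists_le_and_apply_le_iff (hc ω)
  rw [this]
  exact MeasurableSet.iInter fun n ↦ MeasurableSet.iUnion fun k ↦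
    measurableSet_lt (hW _ (min_le_left _ _)) measurable_const

lemma measurableSet_cappedHit_le (m : MeasurableSpace Ω) (hc : ∀ ω, Continuous (W · ω))
    {s : ℝ≥0} (hW : ∀ u ≤ s, Measurable[m] (W u)) (a : ℝ) (M : ℝ≥0) :
    MeasurableSet[m] {ω | cappedHit (W · ω) a M ≤ s} := by
  have : {ω | cappedHit (W · ω) a M ≤ s} = {_ω | M ≤ s} ∪ {ω | ∃ u ≤ s, W u ω ≤ a} := by
    ext ω
    simp only [Set.mem_ofPred_eq, Set.mem_union]
    exact cappedHit_le_iff (hc ω)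
  rw [this]
  exact (MeasurableSet.const _).union (measurableSet_exists_le_apply_le m hc hW a)

variable [mΩ : MeasurableSpace Ω] {P : Measure Ω}

lemma measurable_cappedHit (hc : ∀ ω, Continuous (W · ω)) (hW : ∀ u, Measurable (W u))
    (a : ℝ) (M : ℝ≥0) : Measurable fun ω ↦ cappedHit (W · ω) a M :=
  measurable_of_Iic fun _ ↦ measurableSet_cappedHit_le mΩ hc (fun u _ ↦ hW u) a M

lemma integrable_exp_neg_mul_cappedHit [IsFiniteMeasure P] (hc : ∀ ω, Continuous (W · ω))
    (hW : ∀ u, Measurable (W u)) (a : ℝ) (M : ℝ≥0) {c : ℝ} (h : 0 ≤ c) :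
    Integrable (fun ω ↦ Real.exp (-(c * cappedHit (W · ω) a M))) P := by
  refine Integrable.of_bound
    ((measurable_cappedHit hc hW a M).coe_nnreal_real.const_mul c).neg.exp.aestronglyMeasurable
    1 (ae_of_all _ fun ω ↦ ?_)
  rw [Real.norm_of_nonneg (Real.exp_pos _).le]
  exact Real.exp_le_one_iff.2 (neg_nonpos.2 (by positivity))

/-- The moment generating function of a Brownian increment. -/
lemma integral_exp_neg_mul_sub (hB : IsPreBrownianReal W P) (l : ℝ) {s t : ℝ≥0} (hst : s ≤ t) :
    ∫ ω, Real.exp (-l * (W t ω - W s ω)) ∂P = Real.exp (l ^ 2 * (t - s) / 2) := by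
  have h := mgf_gaussianReal (hB.hasLaw_sub t s).map_eq (-l)
  have hd : ((nndist t.1 s.1 : ℝ≥0) : ℝ) = t - s := by
    rw [coe_nndist, Real.dist_eq]
    exact abs_of_nonneg (sub_nonneg.2 (by exact_mod_cast hst))
  rw [hd] at h
  simp only [mgf, Pi.sub_apply] at h
  rw [h]
  ring_nf

/-- Optional stopping for the exponential martingale `exp (-l W_t - l² t / 2)` at the hitting time of
`-a` capped at `m`, multiplied by the constant `exp (-l a)`. -/
lemma integral_exp_stopped_eq [IsProbabilityMeasure P] (hB : IsPreBrownianReal W P)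
    (hW : ∀ t, Measurable (W t)) (hc : ∀ ω, Continuous (W · ω)) {a l : ℝ} (ha : 0 ≤ a)
    (hl : 0 ≤ l) (m : ℕ) :
    ∫ ω, Real.exp (-l * (W (cappedHit (W · ω) (-a) m) ω + a))
      * Real.exp (-(l ^ 2 / 2 * cappedHit (W · ω) (-a) m)) ∂P = Real.exp (-l * a) := by
  let τ : Ω → ℝ≥0 := fun ω ↦ cappedHit (W · ω) (-a) m
  -- `W τ ≥ -a`, hence capping `exp (-l * (W s + a))` at `1` makes no difference at `τ`,
  -- and it provides the domination of the process up to time `m`.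
  let Z : ℝ≥0 → Ω → ℝ := fun s ω ↦ min 1 (Real.exp (-l * (W s ω + a)))
  let V : ℝ≥0 → Ω → ℝ := fun s ω ↦ Real.exp (-l * (W m ω - W s ω))
  let v : ℝ≥0 → ℝ := fun s ↦ Real.exp (l ^ 2 * (m - s) / 2)
  have h0 : ∀ᵐ ω ∂P, Z (τ ω) ω = Real.exp (-l * (W (τ ω) ω + a)) := by
    filter_upwards [hB.eval_zero_ae_eq_zero] with ω hω
    refine min_eq_right (Real.exp_le_one_iff.2 ?_)
    have : -a ≤ W (τ ω) ω := le_apply_cappedHit (hc ω) (by simp only [hω]; linarith) _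
    nlinarith
  -- The past of `W`; the increment `W m - W s` is independent of it by the weak Markov property.
  let F := Filtration.natural W fun t ↦ (hW t).stronglyMeasurable
  have hFW : ∀ s, ∀ u ≤ s, Measurable[F s] (W u) := fun s u hu ↦
    Measurable.mono (comap_measurable (W u))
      (le_iSup₂ (f := fun j (_ : j ≤ s) ↦ MeasurableSpace.comap (W j) inferInstance) u hu) le_rfl
  have hint : Integrable (fun ω ↦ Real.exp (-l * W m ω)) P := by
    have h := integrable_exp_mul_gaussianReal (μ := 0) (v := (m : ℝ≥0)) (-l)
    rw [← (hB.hasLaw_eval m).map_eq] at h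
    exact h.comp_measurable (hW m)
  have key := integral_mul_stopped_eq (P := P) F (t := m) (τ := τ) (Z := Z) (V := V) (v := v)
    (fun s ↦ measurableSet_cappedHit_le (F s) hc (hFW s) _ _) (fun ω ↦ by
      exact_mod_cast cappedHit_le _ _ _)
    (fun s ↦ by
      have := hFW s s le_rfl
      fun_prop)
    (fun s ↦ by fun_prop)
    (fun s hs ↦ by
      have h := (hB.indepFun_shift s).symm
      have hV : V s = (fun f : ℝ≥0 → ℝ ↦ Real.exp (-l * f (m - s))) ∘
          fun ω t ↦ W (s + t) ω - W s ω := by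
        ext ω
        simp [V, add_tsub_cancel_of_le hs]
      have h2 := h.comp (φ := id) (ψ := fun f : ℝ≥0 → ℝ ↦ Real.exp (-l * f (m - s)))
        measurable_id (by fun_prop)
      rw [← hV] at h2
      rw [show F s = _ from Filtration.natural_eq_comap W _ s]
      exact h2)
    (fun s hs ↦ by simpa [V, v] using integral_exp_neg_mul_sub hB l hs)
    (fun ω ↦ by have := hc ω; fun_prop) (fun ω ↦ by have := hc ω; fun_prop) (by fun_prop)
    (D := fun ω ↦ Real.exp (-l * a) * Real.exp (-l * W m ω)) (hint.const_mul _)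
    (fun s hs ω ↦ by
      rw [Real.norm_of_nonneg (by positivity)]
      calc Z s ω * V s ω ≤ Real.exp (-l * (W s ω + a)) * V s ω :=
            mul_le_mul_of_nonneg_right (min_le_right _ _) (Real.exp_pos _).le
        _ = _ := by simp only [V]; rw [← Real.exp_add, ← Real.exp_add]; ring_nf)
    (C := Real.exp (l ^ 2 * m / 2))
    (fun s hs ω ↦ by
      rw [Real.norm_of_nonneg (by positivity)]
      refine (mul_le_of_le_one_left (Real.exp_pos _).le (min_le_left _ _)).trans ?_
      refine Real.exp_le_exp.2 ?_
      have := s.coe_nonneg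
      gcongr
      linarith)
  have hl1 : ∫ ω, Z (τ ω) ω * V (τ ω) ω ∂P = Real.exp (-l * a) * Real.exp (l ^ 2 * m / 2) := by
    have h1 : ∫ ω, Z (τ ω) ω * V (τ ω) ω ∂P
        = ∫ ω, Real.exp (-l * a) * Real.exp (-l * (W m ω - W 0 ω)) ∂P := by
      refine integral_congr_ae ?_
      filter_upwards [h0, hB.eval_zero_ae_eq_zero] with ω h1 h2
      simp only [V]
      rw [h1, h2, ← Real.exp_add, ← Real.exp_add]
      ring_nf
    rw [h1, integral_const_mul, integral_exp_neg_mul_sub hB l zero_le]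
    simp
  have hr1 : ∫ ω, Z (τ ω) ω * v (τ ω) ∂P = Real.exp (l ^ 2 * m / 2) *
      ∫ ω, Real.exp (-l * (W (τ ω) ω + a)) * Real.exp (-(l ^ 2 / 2 * τ ω)) ∂P := by
    rw [← integral_const_mul]
    refine integral_congr_ae ?_
    filter_upwards [h0] with ω h1
    simp only [v]
    rw [h1, ← Real.exp_add, ← Real.exp_add, ← Real.exp_add]
    ring_nf
  rw [hl1, hr1, mul_comm] at key
  exact (mul_left_cancel₀ (Real.exp_pos _).ne' key).symm

/-- The Laplace transform of the hitting time of `-a`, up to the error made by capping it. -/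
lemma abs_integral_exp_cappedHit_sub_le [IsProbabilityMeasure P] (hB : IsPreBrownianReal W P)
    (hW : ∀ t, Measurable (W t)) (hc : ∀ ω, Continuous (W · ω)) {a l : ℝ} (ha : 0 ≤ a)
    (hl : 0 ≤ l) (m : ℕ) :
    |∫ ω, Real.exp (-(l ^ 2 / 2 * cappedHit (W · ω) (-a) m)) ∂P - Real.exp (-l * a)|
      ≤ Real.exp (-(l ^ 2 / 2 * m)) := by
  let τ : Ω → ℝ≥0 := fun ω ↦ cappedHit (W · ω) (-a) m
  have hτ : Measurable τ := measurable_cappedHit hc hW _ _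
  have hWτ : Measurable fun ω ↦ W (τ ω) ω :=
    (measurable_uncurry_of_continuous_of_measurable hc hW).comp (hτ.prodMk measurable_id)
  have hge : ∀ᵐ ω ∂P, -a ≤ W (τ ω) ω := by
    filter_upwards [hB.eval_zero_ae_eq_zero] with ω hω
    exact le_apply_cappedHit (hc ω) (by simp only [hω]; linarith) _
  have hle1 : ∀ᵐ ω ∂P, Real.exp (-l * (W (τ ω) ω + a)) ≤ 1 := by
    filter_upwards [hge] with ω h
    refine Real.exp_le_one_iff.2 ?_
    nlinarith
  have hle2 : ∀ ω, Real.exp (-(l ^ 2 / 2 * τ ω)) ≤ 1 := fun ω ↦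
    Real.exp_le_one_iff.2 (neg_nonpos.2 (by positivity))
  rw [← integral_exp_stopped_eq hB hW hc ha hl m, ← Real.norm_eq_abs, ← integral_sub]
  · refine (norm_integral_le_of_norm_le_const (C := Real.exp (-(l ^ 2 / 2 * m))) ?_).trans (by simp)
    filter_upwards [hge, hle1] with ω h1 h2
    -- Either `W τ = -a` and the two integrands agree, or `τ = m` and both are at most
    -- `exp (-l² m / 2)`.
    rcases cappedHit_mem (hc ω) (-a) m with h | h
    · have : W (τ ω) ω = -a := le_antisymm h h1
      simp only [τ] at this
      rw [this]
      simp [Real.exp_nonneg]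
    · simp only [τ] at h2
      rw [h] at h2 ⊢
      rw [← one_sub_mul, norm_mul, Real.norm_of_nonneg (sub_nonneg.2 h2),
        Real.norm_of_nonneg (Real.exp_pos _).le]
      simp only [NNReal.coe_natCast]
      refine mul_le_of_le_one_left (Real.exp_pos _).le ?_
      linarith [Real.exp_pos (-l * (W m ω + a))]
  · exact integrable_exp_neg_mul_cappedHit hc hW _ _ (by positivity)
  · refine Integrable.of_bound (((hWτ.add_const a).const_mul (-l)).exp.mul
      (hτ.coe_nnreal_real.const_mul (l ^ 2 / 2)).neg.exp).aestronglyMeasurable 1 ?_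
    filter_upwards [hle1] with ω h
    rw [Real.norm_of_nonneg (by positivity)]
    exact mul_le_one₀ h (Real.exp_pos _).le (hle2 ω)

lemma tendsto_exp_neg_mul_natCast {c : ℝ} (hc : 0 < c) :
    Tendsto (fun m : ℕ ↦ Real.exp (-(c * m))) atTop (𝓝 0) :=
  Real.tendsto_exp_neg_atTop_nhds_zero.comp
    (tendsto_natCast_atTop_atTop.const_mul_atTop hc)

lemma tendsto_integral_exp_cappedHit [IsProbabilityMeasure P] (hB : IsPreBrownianReal W P)
    (hW : ∀ t, Measurable (W t)) (hc : ∀ ω, Continuous (W · ω)) {a : ℝ} (ha : 0 ≤ a) (ξ : ℝ) :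
    Tendsto (fun m : ℕ ↦ ∫ ω, Real.exp (-(ξ ^ 2 / 2 * cappedHit (W · ω) (-a) m)) ∂P) atTop
      (𝓝 (Real.exp (-|ξ| * a))) := by
  rcases eq_or_ne ξ 0 with rfl | hξ
  · simp
  · rw [tendsto_iff_norm_sub_tendsto_zero]
    refine squeeze_zero (fun _ ↦ norm_nonneg _) (fun m ↦ ?_)
      (tendsto_exp_neg_mul_natCast (c := ξ ^ 2 / 2) (by positivity))
    have := abs_integral_exp_cappedHit_sub_le hB hW hc ha (abs_nonneg ξ) m
    simpa only [sq_abs, Real.norm_eq_abs] using this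

/-- Brownian motion reaches every negative level: the Laplace transform at `l² / 2` of the hitting
time is `exp (-l a)`, and tends to `1` as `l` tends to `0`. -/
lemma ae_exists_apply_le [IsProbabilityMeasure P] (hB : IsPreBrownianReal W P)
    (hW : ∀ t, Measurable (W t)) (hc : ∀ ω, Continuous (W · ω)) {a : ℝ} (ha : 0 ≤ a) :
    ∀ᵐ ω ∂P, ∃ u, W u ω ≤ -a := by
  let H : Set Ω := {ω | ∃ u, W u ω ≤ -a}
  have hH : MeasurableSet H := by
    have : H = ⋃ m : ℕ, {ω | ∃ u ≤ (m : ℝ≥0), W u ω ≤ -a} := by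
      ext ω
      simp only [H, Set.mem_ofPred_eq, Set.mem_iUnion]
      refine ⟨fun ⟨u, hu⟩ ↦ ?_, fun ⟨_, u, _, hu⟩ ↦ ⟨u, hu⟩⟩
      obtain ⟨m, hm⟩ := exists_nat_ge u
      exact ⟨m, u, hm, hu⟩
    rw [this]
    exact MeasurableSet.iUnion fun m ↦
      measurableSet_exists_le_apply_le mΩ hc (fun u _ ↦ hW u) _
  -- Off the event `H` the capped hitting time is `m`, so that the Laplace transform at `l² / 2` is
  -- at most `P(H) + exp (-l² m / 2)`.
  have hle : ∀ l : ℝ, 0 < l → Real.exp (-l * a) ≤ P.real H := by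
    intro l hl
    have h1 := tendsto_integral_exp_cappedHit hB hW hc ha l
    have h2 : Tendsto (fun m : ℕ ↦ P.real H + Real.exp (-(l ^ 2 / 2 * m))) atTop
        (𝓝 (P.real H + 0)) :=
      tendsto_const_nhds.add (tendsto_exp_neg_mul_natCast (by positivity))
    rw [add_zero] at h2
    rw [abs_of_pos hl] at h1
    refine le_of_tendsto_of_tendsto' h1 h2 fun m ↦ ?_
    have h3 : ∫ ω, (H.indicator 1 ω + Real.exp (-(l ^ 2 / 2 * m))) ∂P =
        P.real H + Real.exp (-(l ^ 2 / 2 * m)) := by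
      have hi : Integrable (H.indicator (1 : Ω → ℝ)) P := (integrable_const (1 : ℝ)).indicator hH
      rw [integral_add hi (integrable_const _), integral_indicator_one hH]
      simp
    rw [← h3]
    refine integral_mono ?_ (((integrable_const (1 : ℝ)).indicator hH).add (integrable_const _))
      fun ω ↦ ?_
    · exact integrable_exp_neg_mul_cappedHit hc hW _ _ (by positivity)
    · by_cases hω : ω ∈ H
      · simp only [hω, Set.indicator_of_mem, Pi.one_apply]
        have : Real.exp (-(l ^ 2 / 2 * cappedHit (W · ω) (-a) m)) ≤ 1 :=
          Real.exp_le_one_iff.2 (neg_nonpos.2 (by positivity))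
        linarith [Real.exp_pos (-(l ^ 2 / 2 * m))]
      · have : cappedHit (W · ω) (-a) m = m :=
          (cappedHit_mem (hc ω) (-a) m).resolve_left fun h ↦ hω ⟨_, h⟩
        simp [hω, this]
  have h1 : 1 ≤ P.real H := by
    have ht : Tendsto (fun l : ℝ ↦ Real.exp (-l * a)) (𝓝[>] 0) (𝓝 1) := by
      have : Continuous fun l : ℝ ↦ Real.exp (-l * a) := by fun_prop
      simpa using (this.tendsto 0).mono_left nhdsWithin_le_nhds
    exact le_of_tendsto ht (eventually_mem_nhdsWithin.mono hle)
  have h2 : P H = 1 := by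
    rw [← ENNReal.ofReal_one, ← le_antisymm measureReal_le_one h1, ofReal_measureReal]
  exact (prob_compl_eq_zero_iff hH).2 h2

/-- Since `τ` depends on `W` only, `X τ` is conditionally on `W` a centred Gaussian variable of
variance `τ`. -/
lemma integral_cexp_cappedHit_eq [IsProbabilityMeasure P] (hX : IsPreBrownianReal X P)
    (hXm : ∀ t, Measurable (X t)) (hXc : ∀ ω, Continuous (X · ω))
    (hW : ∀ t, Measurable (W t)) (hc : ∀ ω, Continuous (W · ω))
    (hind : IndepFun (fun ω t ↦ X t ω) (fun ω t ↦ W t ω) P) (a ξ : ℝ) (m : ℕ) :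
    ∫ ω, Complex.exp (ξ * X (cappedHit (W · ω) a m) ω * Complex.I) ∂P =
      ((∫ ω, Real.exp (-(ξ ^ 2 / 2 * cappedHit (W · ω) a m)) ∂P : ℝ) : ℂ) := by
  -- The constant filtration given by the whole path of `W`: every time that depends on `W` only is a
  -- stopping time for it.
  have hWpath : Measurable fun ω t ↦ W t ω := measurable_pi_lambda _ hW
  let F : Filtration ℝ≥0 mΩ := Filtration.const _
    (MeasurableSpace.comap (fun ω t ↦ W t ω) inferInstance) hWpath.comap_le
  have hFW : ∀ s u, Measurable[F s] (W u) := fun s u ↦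
    (measurable_pi_apply u).comp (comap_measurable (fun ω t ↦ W t ω))
  have key := integral_mul_stopped_eq (P := P) F (t := m) (τ := fun ω ↦ cappedHit (W · ω) a m)
    (Z := fun _ _ ↦ (1 : ℂ)) (V := fun s ω ↦ Complex.exp (ξ * X s ω * Complex.I))
    (v := fun s ↦ (Real.exp (-(ξ ^ 2 / 2 * s)) : ℂ))
    (fun s ↦ measurableSet_cappedHit_le (F s) hc (fun u _ ↦ hFW s u) _ _)
    (fun ω ↦ by exact_mod_cast cappedHit_le _ _ _) (fun s ↦ measurable_const)
    (fun s ↦ by fun_prop)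
    (fun s hs ↦ hind.symm.comp (φ := id)
      (ψ := fun f : ℝ≥0 → ℝ ↦ Complex.exp (ξ * f s * Complex.I)) measurable_id (by fun_prop))
    (fun s hs ↦ by
      have h := charFun_gaussianReal (μ := 0) (v := s) ξ
      rw [← (hX.hasLaw_eval s).map_eq, charFun_apply_real,
        integral_map (hXm s).aemeasurable (by fun_prop)] at h
      rw [h]
      push_cast
      ring_nf)
    (fun ω ↦ continuous_const) (fun ω ↦ by have := hXc ω; fun_prop) (by fun_prop)
    (D := fun _ ↦ 1) (integrable_const _)
    (fun s hs ω ↦ by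
      rw [one_mul, ← Complex.ofReal_mul, Complex.norm_exp_ofReal_mul_I])
    (C := 1)
    (fun s hs ω ↦ by
      rw [one_mul, Complex.norm_real, Real.norm_of_nonneg (Real.exp_pos _).le]
      exact Real.exp_le_one_iff.2 (neg_nonpos.2 (by positivity)))
  simp only [one_mul] at key
  rw [key]
  exact integral_ofReal

/-- The position of a Brownian motion `X` at the time when an independent Brownian motion first
reaches `-1` is Cauchy distributed. -/
lemma hasLaw_apply_hit_cauchyMeasure [IsProbabilityMeasure P] (hX : IsPreBrownianReal X P)
    (hXm : ∀ t, Measurable (X t)) (hXc : ∀ ω, Continuous (X · ω)) (hB : IsPreBrownianReal W P)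
    (hW : ∀ t, Measurable (W t)) (hc : ∀ ω, Continuous (W · ω))
    (hind : IndepFun (fun ω t ↦ X t ω) (fun ω t ↦ W t ω) P) :
    HasLaw (fun ω ↦ X (sInf {s | W s ω ≤ -1}) ω) (cauchyMeasure 0 1) P := by
  have hτ : ∀ m : ℕ, Measurable fun ω ↦ X (cappedHit (W · ω) (-1) m) ω := fun m ↦
    (measurable_uncurry_of_continuous_of_measurable hXc hXm).comp
      ((measurable_cappedHit hc hW _ _).prodMk measurable_id)
  have hlim : ∀ᵐ ω ∂P, Tendsto (fun m : ℕ ↦ X (cappedHit (W · ω) (-1) m) ω) atTop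
      (𝓝 (X (sInf {s | W s ω ≤ -1}) ω)) := by
    filter_upwards [ae_exists_apply_le hB hW hc zero_le_one] with ω hω
    -- The capped hitting time is eventually equal to the hitting time.
    refine tendsto_const_nhds.congr' ?_
    obtain ⟨M, hM⟩ := exists_nat_ge (sInf {s | W s ω ≤ -1})
    filter_upwards [eventually_ge_atTop M] with m hm
    rw [cappedHit_eq_sInf hω (hM.trans (by exact_mod_cast hm))]
  have hmeas : AEMeasurable (fun ω ↦ X (sInf {s | W s ω ≤ -1}) ω) P :=
    aemeasurable_of_tendsto_metrizable_ae atTop (fun m ↦ (hτ m).aemeasurable) hlim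
  refine ⟨hmeas, ?_⟩
  have := Measure.isProbabilityMeasure_map hmeas
  refine Measure.ext_of_charFun (funext fun ξ ↦ ?_)
  rw [charFun_cauchyMeasure_zero_one, charFun_apply_real, integral_map hmeas (by fun_prop)]
  have h1 : Tendsto (fun m : ℕ ↦
      ∫ ω, Complex.exp (ξ * X (cappedHit (W · ω) (-1) m) ω * Complex.I) ∂P) atTop
      (𝓝 (∫ ω, Complex.exp (ξ * X (sInf {s | W s ω ≤ -1}) ω * Complex.I) ∂P)) := by
    refine tendsto_integral_of_dominated_convergence (fun _ ↦ 1) (fun m ↦ ?_) (integrable_const _)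
      (fun m ↦ ae_of_all _ fun ω ↦ ?_) ?_
    · exact ((Complex.measurable_ofReal.comp (hτ m)).const_mul (ξ : ℂ)
        |>.mul_const Complex.I).cexp.aestronglyMeasurable
    · rw [← Complex.ofReal_mul, Complex.norm_exp_ofReal_mul_I]
    · filter_upwards [hlim] with ω hω
      have hcont : Continuous fun x : ℝ ↦ Complex.exp (ξ * x * Complex.I) := by fun_prop
      exact (hcont.tendsto _).comp hω
  have h2 := (Complex.continuous_ofReal.tendsto _).comp
    (tendsto_integral_exp_cappedHit hB hW hc zero_le_one ξ)
  rw [mul_one] at h2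
  refine tendsto_nhds_unique h1 (h2.congr fun m ↦ ?_)
  exact (integral_cexp_cappedHit_eq hX hXm hXc hW hc hind (-1) ξ m).symm

end Hitting

/-! ### The exit from the upper half-plane -/

theorem mainTheorem1 {Ω : Type*} [MeasurableSpace Ω] (P : Measure Ω) [IsProbabilityMeasure P]
    (B : ℝ≥0 → Ω → ℂ) (hB : IsComplexBrownian B Complex.I P)
    (T : Ω → WithTop ℝ≥0) (hT : T = exitTime B {z : ℂ | 0 < z.im}) :
    (∀ᵐ ω ∂P, T ω < ⊤) ∧
      HasLaw (stoppedValue B T) ((cauchyMeasure 0 1).map (fun x : ℝ ↦ (x : ℂ))) P := by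
  obtain ⟨hX, hW, hind⟩ := hB
  obtain ⟨X', hXm, hXc, hXX'⟩ :=
    exists_measurable_continuous_modification hX.aemeasurable hX.cont
  obtain ⟨W', hWm, hWc, hWW'⟩ :=
    exists_measurable_continuous_modification hW.aemeasurable hW.cont
  have hX' := hX.toIsPreBrownianReal.congr fun t ↦ hXX'.mono fun ω h ↦ h t
  have hW' := hW.toIsPreBrownianReal.congr fun t ↦ hWW'.mono fun ω h ↦ h t
  have hind' := hind.process_congr (fun t ↦ hXX'.mono fun ω h ↦ h t)
    (fun t ↦ hWW'.mono fun ω h ↦ h t)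
  have hhit := ae_exists_apply_le hW' hWm hWc zero_le_one
  -- The exit time from the upper half-plane is the time when `Im B - 1` first reaches `-1`.
  have hexit : ∀ᵐ ω ∂P, T ω = (sInf {s | W' s ω ≤ -1} : ℝ≥0) := by
    filter_upwards [hhit, hWW'] with ω h1 h2
    have hiff : ∀ s, B s ω ∈ {z : ℂ | 0 < z.im}ᶜ ↔ W' s ω ≤ -1 := fun s ↦ by
      rw [← h2 s]
      simp only [Complex.sub_im, Complex.I_im, Set.mem_compl_iff, Set.mem_ofPred_eq, not_lt]
      constructor <;> intro h <;> linarith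
    rw [hT, exitTime, hittingAfter_def]
    simp only [hiff, zero_le, true_and]
    exact if_pos (h1.imp fun s hs ↦ ⟨zero_le, (hiff s).2 hs⟩)
  have hlaw := hasLaw_apply_hit_cauchyMeasure hX' hXm hXc hW' hWm hWc hind'
  refine ⟨hexit.mono fun ω h ↦ by rw [h]; exact WithTop.coe_lt_top _, ?_⟩
  have hofReal : HasLaw (fun x : ℝ ↦ (x : ℂ)) ((cauchyMeasure 0 1).map (fun x : ℝ ↦ (x : ℂ)))
      (cauchyMeasure 0 1) := ⟨by fun_prop, rfl⟩
  refine (hofReal.comp hlaw).congr ?_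
  filter_upwards [hexit, hhit, hXX', hWW', hW'.eval_zero_ae_eq_zero] with ω h1 h2 h3 h4 h5
  rw [stoppedValue, h1]
  change B (sInf {s | W' s ω ≤ -1}) ω = X' (sInf {s | W' s ω ≤ -1}) ω
  have him : W' (sInf {s | W' s ω ≤ -1}) ω = -1 := apply_sInf_eq (hWc ω) (by simp [h5]) h2
  apply Complex.ext
  · have := h3 (sInf {s | W' s ω ≤ -1})
    simpa using this
  · have := h4 (sInf {s | W' s ω ≤ -1})
    rw [him] at this
    simp only [Complex.sub_im, Complex.I_im] at this
    rw [Complex.ofReal_im]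
    linarith
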